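/- Let $G$ be a countable group with lower central series $G=G^0\supseteq G^1\supseteq\cdots$, $G^{k+1}=[G^k,G]$, and suppose that $\bigcap_{k\ge 0}G^k=\{1\}$. A left ordering of a group is a strict total order $<$ on it such that $a<b$ implies $ca<cb$; a bi-ordering is a left ordering for which also $a<b$ implies $ac<bc$. The set $LO(G)$ of left orderings of $G$ carries the smallest topology for which all sets $U_{a,b}=\{<\;:\;a<b\}$, $a,b\in G$, are open, and the set $BiO(G)\subseteq LO(G)$ of bi-orderings carries the subspace topology. A bi-ordering of $G$ is called standard if there are orderings $<_k$ of the (abelian) groups $G^k/G^{k+1}$, $k\ge 0$, such that, for every $k$ and every $g\in G^k\setminus G^{k+1}$, one has $1<g$ if and only if $1<_k gG^{k+1}$. Let $SBiO(G)\subseteq BiO(G)$ be the set of standard bi-orderings, with the subspace topology. (1) $SBiO(G)$ is a closed subset of $BiO(G)$. (2) If $G$ is non-trivial and not isomorphic to $\mathbb Z$, and each factor $G^k/G^{k+1}$ is finitely generated, then $SBiO(G)$ is either empty or homeomorphic to the Cantor set. -/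

import Mathlib

/-- A left ordering of `G`: a strict total order `<` such that `a < b` implies `c a < c b`. -/
@[ext]
structure LeftOrdering (G : Type*) [Mul G] where
  lt : G → G → Prop
  irrefl : ∀ a, ¬ lt a a
  trans : ∀ a b c, lt a b → lt b c → lt a c
  total : ∀ a b, lt a b ∨ a = b ∨ lt b a
  mul_left : ∀ a b c, lt a b → lt (c * a) (c * b)

namespace LeftOrdering

/-- The set `U_{a,b}` of the left orderings for which `a < b`. -/
def U {G : Type*} [Mul G] (a b : G) : Set (LeftOrdering G) := {o | o.lt a b}

/-- The smallest topology on the set of left orderings for which all the sets `U_{a,b}` are open. -/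
instance {G : Type*} [Mul G] : TopologicalSpace (LeftOrdering G) :=
  TopologicalSpace.generateFrom {s | ∃ a b : G, s = U a b}

end LeftOrdering

/-- The set of bi-orderings: the left orderings that are also right orderings.
Its topology is the subspace topology. -/
def BiO (G : Type*) [Mul G] : Set (LeftOrdering G) :=
  {o | ∀ a b c : G, o.lt a b → o.lt (a * c) (b * c)}

/-- The factor `G^k / G^{k+1}` of the lower central series `G = G^0 ⊇ G^1 ⊇ ...`. -/
abbrev LCSFactor (G : Type*) [Group G] (k : ℕ) : Type _ :=
  (Subgroup.lowerCentralSeries (⊤ : Subgroup G) k) ⧸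
    (Subgroup.lowerCentralSeries (⊤ : Subgroup G) (k + 1)).subgroupOf
      (Subgroup.lowerCentralSeries (⊤ : Subgroup G) k)

/-- The set of standard bi-orderings of `G`: those induced by some choice of orderings of the
factors `G^k / G^{k+1}`, an element `g` of `G^k` outside `G^{k+1}` being positive if and only if
its class in `G^k / G^{k+1}` is positive.  (The factors are abelian, so left orderings of them
are the same as bi-orderings.) -/
def SBiO (G : Type*) [Group G] : Set (BiO G) :=
  {o | ∃ f : ∀ k : ℕ, LeftOrdering (LCSFactor G k),
    ∀ (k : ℕ) (g : Subgroup.lowerCentralSeries (⊤ : Subgroup G) k),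
      (g : G) ∉ Subgroup.lowerCentralSeries (⊤ : Subgroup G) (k + 1) →
        (o.1.lt 1 (g : G) ↔ (f k).lt 1 (QuotientGroup.mk g))}

/-!
A bi-ordering is standard if and only if every `G^k` is convex for it, and convexity is a closed
condition.  Since `LO(G)` is compact, so is `SBiO(G)`.

Modulo `G^{k+1}` the group is generated by any lifts of generators of the abelianization `G/G^1`.
So if `G/G^1` is finitely generated then each `G/G^k` is countable, and if `G/G^1` is cyclic and
`⋂ G^k = 1` then `G` itself is cyclic.  A standard ordering is determined by the signs of one
representative of each class of each `G/G^k`, because `G^k` is convex; hence countably many clopen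
sets separate the points of `SBiO(G)`.

A standard ordering remains standard when the ordering it induces on `G/G^1` is replaced,
lexicographically, by any other one, so there are no isolated points as soon as no ordering of
`G/G^1` is determined by the positivity of finitely many elements.  If finitely many elements did
determine an ordering of a finitely generated abelian group, the nonnegative cone would consist of
roots of elements of the monoid that they generate.  In a minimal set `S` with this property no two
elements can be compared, for `y < x` makes `x` redundant; so `S` has at most one element and the
group is cyclic.

Finally, by Brouwer's theorem, a nonempty compact perfect space whose points are separated by
countably many clopen sets is homeomorphic to the Cantor set.
-/

section CantorSpace

variable {X : Type*}

/-- The least index `m` for which `C m` cuts `A` into two nonempty pieces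
(`0` if no `C m` does). -/
noncomputable def splitIndex (C : ℕ → Set X) (A : Set X) : ℕ :=
  sInf {m | (A ∩ C m).Nonempty ∧ (A \ C m).Nonempty}

/-- The cell of level `n` that contains `x` in the binary tree of cells in which every cell `A` is
cut by `C (splitIndex C A)`. -/
def splitCell (C : ℕ → Set X) (x : X) : ℕ → Set X
  | 0 => Set.univ
  | n + 1 => {y ∈ splitCell C x n |
      y ∈ C (splitIndex C (splitCell C x n)) ↔ x ∈ C (splitIndex C (splitCell C x n))}

open scoped Classical in
/-- The branch of the tree of cells along which the point `x` descends. -/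
noncomputable def splitCode (C : ℕ → Set X) (x : X) (n : ℕ) : Bool :=
  decide (x ∈ C (splitIndex C (splitCell C x n)))

variable {C : ℕ → Set X}

theorem mem_splitCell_self (x : X) (n : ℕ) : x ∈ splitCell C x n := by
  induction n with
  | zero => trivial
  | succ n ih => exact ⟨ih, Iff.rfl⟩

theorem splitCell_eq_of_mem {x y : X} {n : ℕ} (h : y ∈ splitCell C x n) :
    splitCell C y n = splitCell C x n := by
  induction n with
  | zero => rfl
  | succ n ih =>
    obtain ⟨hmem, hiff⟩ := h
    simp only [splitCell, ih hmem, hiff]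

theorem mem_splitCell_iff {x y : X} {n : ℕ} :
    y ∈ splitCell C x n ↔ ∀ i < n, splitCode C y i = splitCode C x i := by
  induction n with
  | zero => simp [splitCell]
  | succ n ih =>
    rw [Nat.forall_lt_succ_right, ← ih]
    refine and_congr_right fun h => ?_
    rw [splitCode, splitCode, splitCell_eq_of_mem h, decide_eq_decide]

theorem mem_iff_mem_of_lt_splitIndex {A : Set X} {m : ℕ} (hm : m < splitIndex C A) {x y : X}
    (hx : x ∈ A) (hy : y ∈ A) : x ∈ C m ↔ y ∈ C m := by
  have hsplit := Nat.notMem_of_lt_sInf hm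
  by_contra hxy
  refine hsplit ?_
  by_cases hxm : x ∈ C m
  · exact ⟨⟨x, hx, hxm⟩, ⟨y, hy, fun hym => hxy (iff_of_true hxm hym)⟩⟩
  · exact ⟨⟨y, hy, by_contra fun hym => hxy (iff_of_false hxm hym)⟩, ⟨x, hx, hxm⟩⟩

theorem splitIndex_spec (hsep : ∀ x y, (∀ n, x ∈ C n ↔ y ∈ C n) → x = y) {A : Set X}
    (hA : A.Nontrivial) :
    (A ∩ C (splitIndex C A)).Nonempty ∧ (A \ C (splitIndex C A)).Nonempty := by
  refine Nat.sInf_mem (s := {m | (A ∩ C m).Nonempty ∧ (A \ C m).Nonempty}) ?_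
  obtain ⟨x, hx, y, hy, hxy⟩ := hA
  by_contra hempty
  refine hxy (hsep x y fun m => ?_)
  by_contra hm
  refine hempty ⟨m, ?_⟩
  by_cases hxm : x ∈ C m
  · exact ⟨⟨x, hx, hxm⟩, ⟨y, hy, fun hym => hm (iff_of_true hxm hym)⟩⟩
  · exact ⟨⟨y, hy, by_contra fun hym => hm (iff_of_false hxm hym)⟩, ⟨x, hx, hxm⟩⟩

variable [TopologicalSpace X]

theorem isClopen_splitCell (hC : ∀ n, IsClopen (C n)) (x : X) (n : ℕ) :
    IsClopen (splitCell C x n) := by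
  induction n with
  | zero => exact isClopen_univ
  | succ n ih =>
    by_cases hx : x ∈ C (splitIndex C (splitCell C x n))
    · simp only [splitCell, hx, iff_true]
      exact ih.inter (hC _)
    · simp only [splitCell, hx, iff_false]
      exact ih.inter (hC _).compl

theorem continuous_splitCode (hC : ∀ n, IsClopen (C n)) : Continuous (splitCode C) :=
  continuous_pi fun n => ((IsLocallyConstant.iff_exists_open _).2 fun x =>
    ⟨splitCell C x (n + 1), (isClopen_splitCell hC x _).isOpen, mem_splitCell_self x _,
      fun _ hy => mem_splitCell_iff.1 hy n n.lt_succ_self⟩).continuous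

theorem nontrivial_of_isOpen_of_nonempty [PerfectSpace X] {V : Set X} (hV : IsOpen V)
    (hne : V.Nonempty) : V.Nontrivial := by
  obtain ⟨x, hx⟩ := hne
  obtain ⟨y, ⟨hy, -⟩, hyx⟩ := accPt_iff_nhds.1
    (PerfectSpace.univ_preperfect x (Set.mem_univ x)) V (hV.mem_nhds hx)
  exact ⟨y, hy, x, hx, hyx⟩

section Perfect

variable [PerfectSpace X] (hC : ∀ n, IsClopen (C n))
  (hsep : ∀ x y, (∀ n, x ∈ C n ↔ y ∈ C n) → x = y)

include hC hsep

theorem splitIndex_splitCell_spec (x : X) (n : ℕ) :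
    (splitCell C x n ∩ C (splitIndex C (splitCell C x n))).Nonempty ∧
      (splitCell C x n \ C (splitIndex C (splitCell C x n))).Nonempty :=
  splitIndex_spec hsep (nontrivial_of_isOpen_of_nonempty (isClopen_splitCell hC x n).isOpen
    ⟨x, mem_splitCell_self x n⟩)

theorem mem_iff_mem_of_mem_splitCell {x y : X} {i n : ℕ} (hin : i < n)
    (hy : y ∈ splitCell C x n) : y ∈ C i ↔ x ∈ C i := by
  induction n generalizing i x y with
  | zero => exact absurd hin i.not_lt_zero
  | succ n ih =>
    rcases Nat.lt_succ_iff_lt_or_eq.1 hin with hlt | rfl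
    · exact ih hlt hy.1
    have hle : i ≤ splitIndex C (splitCell C x i) := by
      by_contra! hlt
      obtain ⟨⟨u, hu, hu'⟩, ⟨v, hv, hv'⟩⟩ := splitIndex_splitCell_spec hC hsep x i
      exact hv' ((ih hlt hv).2 ((ih hlt hu).1 hu'))
    rcases hle.lt_or_eq with hlt | heq
    · exact mem_iff_mem_of_lt_splitIndex hlt hy.1 (mem_splitCell_self x i)
    · have hiff := hy.2
      rwa [← heq] at hiff

theorem splitCode_injective : Function.Injective (splitCode C) := fun x y hxy =>
  hsep x y fun n => mem_iff_mem_of_mem_splitCell hC hsep n.lt_succ_self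
    (mem_splitCell_iff.2 fun i _ => congrFun hxy i)

theorem denseRange_splitCode [Nonempty X] : DenseRange (splitCode C) := by
  have hprefix (s : ℕ → Bool) (n : ℕ) : ∃ x, ∀ i < n, splitCode C x i = s i := by
    induction n with
    | zero => exact ⟨Classical.arbitrary X, fun i hi => absurd hi i.not_lt_zero⟩
    | succ n ih =>
      obtain ⟨x, hx⟩ := ih
      obtain ⟨y, hy, hyn⟩ : ∃ y ∈ splitCell C x n, splitCode C y n = s n := by
        obtain ⟨⟨u, hu, hu'⟩, ⟨v, hv, hv'⟩⟩ := splitIndex_splitCell_spec hC hsep x n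
        cases s n with
        | false => exact ⟨v, hv, by simpa [splitCode, splitCell_eq_of_mem hv] using hv'⟩
        | true => exact ⟨u, hu, by simpa [splitCode, splitCell_eq_of_mem hu] using hu'⟩
      exact ⟨y, Nat.forall_lt_succ_right.2
        ⟨fun i hi => (mem_splitCell_iff.1 hy i hi).trans (hx i hi), hyn⟩⟩
  refine (PiNat.isTopologicalBasis_cylinders fun _ => Bool).dense_iff.2 ?_
  rintro _ ⟨s, n, rfl⟩ -
  obtain ⟨x, hx⟩ := hprefix s n
  exact ⟨splitCode C x, PiNat.mem_cylinder_iff.2 hx, x, rfl⟩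

theorem nonempty_homeomorph_nat_bool [CompactSpace X] [Nonempty X] :
    Nonempty (X ≃ₜ (ℕ → Bool)) := by
  have hcont := continuous_splitCode hC
  have hsurj : Function.Surjective (splitCode C) := Set.range_eq_univ.1 <|
    (isCompact_range hcont).isClosed.closure_eq.symm.trans
      (denseRange_splitCode hC hsep).closure_range
  exact ⟨Continuous.homeoOfEquivCompactToT2
    (f := Equiv.ofBijective _ ⟨splitCode_injective hC hsep, hsurj⟩) hcont⟩

end Perfect

end CantorSpace

namespace LeftOrdering

section Mul

variable {G : Type*} [Mul G]

theorem asymm (o : LeftOrdering G) {a b : G} (h : o.lt a b) : ¬ o.lt b a :=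
  fun h' => o.irrefl a (o.trans _ _ _ h h')

theorem lt_or_gt_of_ne (o : LeftOrdering G) {a b : G} (h : a ≠ b) : o.lt a b ∨ o.lt b a :=
  (o.total a b).imp_right fun h' => h'.resolve_left h

theorem isOpen_U (a b : G) : IsOpen (U a b) :=
  TopologicalSpace.isOpen_generateFrom_of_mem ⟨a, b, rfl⟩

theorem compl_U_of_ne {a b : G} (h : a ≠ b) : (U a b)ᶜ = U b a :=
  Set.ext fun o => ⟨fun hab => (o.lt_or_gt_of_ne h).resolve_left hab, fun hba => o.asymm hba⟩

theorem U_self (a : G) : U a a = ∅ :=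
  Set.eq_empty_of_forall_notMem fun o => o.irrefl a

theorem isClopen_U (a b : G) : IsClopen (U a b) := by
  refine ⟨?_, isOpen_U a b⟩
  rcases eq_or_ne a b with rfl | h
  · simp only [U_self, isClosed_empty]
  · exact isOpen_compl_iff.1 (compl_U_of_ne h ▸ isOpen_U b a)

/-- The limit of an ultrafilter of left orderings: `a < b` when `a < b` for almost all of them. -/
def ultralimit (F : Ultrafilter (LeftOrdering G)) : LeftOrdering G where
  lt a b := ∀ᶠ o : LeftOrdering G in F, o.lt a b
  irrefl a h := h.exists.elim fun o => o.irrefl a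
  trans a b c hab hbc := by
    filter_upwards [hab, hbc] with o using o.trans a b c
  total a b := by
    rcases eq_or_ne a b with h | h
    · exact .inr (.inl h)
    · exact (Ultrafilter.eventually_or.1 <| .of_forall fun o => o.lt_or_gt_of_ne h).imp_right .inr
  mul_left a b c hab := by
    filter_upwards [hab] with o using o.mul_left a b c

theorem le_nhds_ultralimit (F : Ultrafilter (LeftOrdering G)) : ↑F ≤ nhds (ultralimit F) := by
  simp only [TopologicalSpace.nhds_generateFrom, le_iInf_iff, Filter.le_principal_iff]
  rintro s ⟨hs, a, b, rfl⟩
  exact hs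

instance : CompactSpace (LeftOrdering G) :=
  ⟨isCompact_iff_ultrafilter_le_nhds.2 fun F _ => ⟨ultralimit F, trivial, le_nhds_ultralimit F⟩⟩

theorem isClosed_BiO : IsClosed (BiO G) := by
  have hBiO : BiO G = ⋂ (a : G) (b : G) (c : G), (U a b)ᶜ ∪ U (a * c) (b * c) := by
    ext o
    simp only [BiO, U, Set.mem_ofPred_eq, Set.mem_iInter, Set.mem_union, Set.mem_compl_iff,
      ← imp_iff_not_or]
  rw [hBiO]
  exact isClosed_iInter fun a => isClosed_iInter fun b => isClosed_iInter fun c =>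
    (isClopen_U _ _).compl.isClosed.union (isClopen_U _ _).isClosed

end Mul

theorem mem_BiO {G : Type*} [CommMagma G] (o : LeftOrdering G) : o ∈ BiO G := fun a b c hab => by
  simpa only [mul_comm c] using o.mul_left a b c hab

section Group

variable {G : Type*} [Group G]

theorem lt_iff_one_lt_inv_mul (o : LeftOrdering G) (a b : G) :
    o.lt a b ↔ o.lt 1 (a⁻¹ * b) :=
  ⟨fun h => by simpa using o.mul_left _ _ a⁻¹ h, fun h => by simpa using o.mul_left _ _ a h⟩

theorem not_one_lt_inv (o : LeftOrdering G) {a : G} (h : o.lt 1 a) : ¬ o.lt 1 a⁻¹ := fun h' =>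
  o.asymm h ((o.lt_iff_one_lt_inv_mul a 1).2 (by simpa using h'))

theorem one_lt_mul (o : LeftOrdering G) {a b : G} (ha : o.lt 1 a) (hb : o.lt 1 b) :
    o.lt 1 (a * b) :=
  o.trans _ _ _ ha (by simpa using o.mul_left _ _ a hb)

theorem ext_one_lt {o o' : LeftOrdering G} (h : ∀ a, o.lt 1 a ↔ o'.lt 1 a) : o = o' := by
  ext a b
  rw [o.lt_iff_one_lt_inv_mul, o'.lt_iff_one_lt_inv_mul, h]

theorem exists_finset_of_mem_nhds {o : LeftOrdering G} {s : Set (LeftOrdering G)}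
    (hs : s ∈ nhds o) :
    ∃ T : Finset G, (∀ g ∈ T, o.lt 1 g) ∧ ∀ o', (∀ g ∈ T, o'.lt 1 g) → o' ∈ s := by
  classical
  obtain ⟨_, ⟨F, ⟨hFfin, hFU⟩, rfl⟩, hoF, hFs⟩ :=
    (TopologicalSpace.isTopologicalBasis_of_subbasis rfl).mem_nhds_iff.1 hs
  have hU : ∀ V ∈ F, ∃ g : G, V = U 1 g := fun V hV => by
    obtain ⟨a, b, rfl⟩ := hFU hV
    exact ⟨a⁻¹ * b, Set.ext fun o => o.lt_iff_one_lt_inv_mul a b⟩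
  choose! g hg using hU
  have hmem (o' : LeftOrdering G) : o' ∈ ⋂₀ F ↔ ∀ y ∈ hFfin.toFinset.image g, o'.lt 1 y := by
    simp only [Finset.forall_mem_image, Set.Finite.mem_toFinset, Set.mem_sInter]
    exact forall₂_congr fun V hV => Set.ext_iff.1 (hg V hV) o'
  exact ⟨hFfin.toFinset.image g, (hmem o).1 hoF, fun o' ho' => hFs ((hmem o').2 ho')⟩

/-- The nonnegative cone of a left ordering. -/
def oneLE (o : LeftOrdering G) : Submonoid G where
  carrier := {a | a = 1 ∨ o.lt 1 a}
  one_mem' := .inl rfl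
  mul_mem' := by
    rintro a b (rfl | ha) (rfl | hb)
    · exact .inl (one_mul 1)
    · exact .inr (by rwa [one_mul])
    · exact .inr (by rwa [mul_one])
    · exact .inr (o.one_lt_mul ha hb)

theorem one_lt_iff (o : LeftOrdering G) {a : G} : o.lt 1 a ↔ a ∈ o.oneLE ∧ a ≠ 1 :=
  ⟨fun h => ⟨.inr h, fun ha => o.irrefl 1 (ha ▸ h)⟩, fun h => h.1.resolve_left h.2⟩

theorem isMulPointed_oneLE (o : LeftOrdering G) : o.oneLE.IsMulPointed := fun _ ha ha' =>
  by_contra fun ha1 => o.not_one_lt_inv (o.one_lt_iff.2 ⟨ha, ha1⟩)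
    (o.one_lt_iff.2 ⟨ha', inv_ne_one.2 ha1⟩)

theorem isMulSpanning_oneLE (o : LeftOrdering G) : o.oneLE.IsMulSpanning := fun a => by
  rcases o.total 1 a with h | h | h
  · exact .inl (.inr h)
  · exact .inl (.inl h.symm)
  · exact .inr (.inr (by simpa using (o.lt_iff_one_lt_inv_mul a 1).1 h))

theorem isMulSpanning_map_oneLE {Q : Type*} [Group Q] (o : LeftOrdering G) {φ : G →* Q}
    (hφ : Function.Surjective φ) : (o.oneLE.map φ).IsMulSpanning := fun q => by
  obtain ⟨a, rfl⟩ := hφ q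
  exact (o.isMulSpanning_oneLE a).imp (Submonoid.mem_map_of_mem _)
    fun ha => map_inv φ a ▸ Submonoid.mem_map_of_mem _ ha

theorem eq_one_of_pow_eq_one (o : LeftOrdering G) {a : G} {n : ℕ} (hn : n ≠ 0)
    (h : a ^ n = 1) : a = 1 := by
  obtain ⟨n, rfl⟩ := Nat.exists_eq_succ_of_ne_zero hn
  have hinv : a⁻¹ = a ^ n := inv_eq_of_mul_eq_one_left (by rwa [← pow_succ])
  rcases o.isMulSpanning_oneLE a with ha | ha
  · exact o.isMulPointed_oneLE a ha (hinv ▸ pow_mem ha n)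
  · refine inv_eq_one.1 (o.isMulPointed_oneLE _ ha ?_)
    rw [hinv, ← inv_pow]
    exact pow_mem ha n

theorem infinite [Nontrivial G] (o : LeftOrdering G) : Infinite G := by
  obtain ⟨g, hg⟩ := exists_ne (1 : G)
  refine not_finite_iff_infinite.1 fun _ => hg ?_
  exact o.eq_one_of_pow_eq_one (orderOf_pos g).ne' (pow_orderOf_eq_one g)

/-- The left ordering whose nonnegative cone is `M`. -/
def ofCone (M : Submonoid G) (hp : M.IsMulPointed) (hs : M.IsMulSpanning) : LeftOrdering G where
  lt a b := a⁻¹ * b ∈ M ∧ a ≠ b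
  irrefl a h := h.2 rfl
  trans a b c hab hbc := by
    have hac : a⁻¹ * c ∈ M := by simpa [mul_assoc] using mul_mem hab.1 hbc.1
    refine ⟨hac, ?_⟩
    rintro rfl
    exact hab.2 (inv_mul_eq_one.1 (hp _ hab.1 (by simpa using hbc.1)))
  total a b := by
    rcases eq_or_ne a b with h | h
    · exact .inr (.inl h)
    · exact (hs (a⁻¹ * b)).imp (fun hab => ⟨hab, h⟩)
        fun hba => .inr ⟨by simpa using hba, h.symm⟩
  mul_left a b c h := ⟨by simpa [mul_assoc] using h.1, fun h' => h.2 (mul_left_cancel h')⟩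

theorem oneLE_ofCone {M : Submonoid G} (hp : M.IsMulPointed) (hs : M.IsMulSpanning) :
    (ofCone M hp hs).oneLE = M := by
  ext a
  change a = 1 ∨ 1⁻¹ * a ∈ M ∧ 1 ≠ a ↔ a ∈ M
  rw [inv_one, one_mul]
  refine ⟨?_, fun ha => or_iff_not_imp_left.2 fun h => ⟨ha, Ne.symm h⟩⟩
  rintro (rfl | h)
  · exact M.one_mem
  · exact h.1

/-- The restriction of a left ordering to a subgroup. -/
def restrict (o : LeftOrdering G) (K : Subgroup G) : LeftOrdering K where
  lt a b := o.lt a b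
  irrefl a := o.irrefl a
  trans a b c := o.trans a b c
  total a b := by simpa only [Subtype.ext_iff] using o.total a b
  mul_left a b c := o.mul_left a b c

/-- A subgroup is convex for a left ordering if it contains every element that lies between `1`
and one of its elements. -/
def IsConvex (o : LeftOrdering G) (N : Subgroup G) : Prop :=
  ∀ ⦃g n⦄, n ∈ N → o.lt 1 g → o.lt g n → g ∈ N

namespace IsConvex

variable {o : LeftOrdering G} {N K : Subgroup G}

theorem subgroupOf (h : o.IsConvex N) (K : Subgroup G) :
    (o.restrict K).IsConvex (N.subgroupOf K) := fun _ _ hn hg hgn => h hn hg hgn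

theorem of_subgroupOf (hNK : N ≤ K) (hK : o.IsConvex K)
    (h : (o.restrict K).IsConvex (N.subgroupOf K)) : o.IsConvex N := fun g n hn hg hgn =>
  h (g := ⟨g, hK (hNK hn) hg hgn⟩) (n := ⟨n, hNK hn⟩) hn hg hgn

theorem one_lt_mul (h : o.IsConvex N) {g n : G} (hg : g ∉ N) (hn : n ∈ N) (hpos : o.lt 1 g) :
    o.lt 1 (g * n) := by
  by_contra hneg
  have hgn : g * n ≠ 1 := fun h1 => hg ((N.mul_mem_cancel_right hn).1 (h1 ▸ N.one_mem))
  have hlt : o.lt (g * n) 1 := (o.lt_or_gt_of_ne hgn).resolve_right hneg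
  have hmem : (g * n)⁻¹ ∈ N := h (N.inv_mem hn)
    (by simpa using (o.lt_iff_one_lt_inv_mul _ _).1 hlt)
    ((o.lt_iff_one_lt_inv_mul _ _).2 (by simpa using hpos))
  exact hg ((N.mul_mem_cancel_right hn).1 (N.inv_mem_iff.1 hmem))

theorem one_lt_mul_iff (h : o.IsConvex N) {g n : G} (hg : g ∉ N) (hn : n ∈ N) :
    o.lt 1 (g * n) ↔ o.lt 1 g := by
  refine ⟨fun hpos => ?_, h.one_lt_mul hg hn⟩
  have hgn : g * n ∉ N := fun hmem => hg ((N.mul_mem_cancel_right hn).1 hmem)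
  simpa using h.one_lt_mul hgn (N.inv_mem hn) hpos

variable [N.Normal]

theorem isMulPointed_map_oneLE (h : o.IsConvex N) :
    (o.oneLE.map (QuotientGroup.mk' N)).IsMulPointed := by
  rintro _ ⟨a, ha, rfl⟩ ⟨b, hb, hba⟩
  by_contra ha1
  have haN : a ∉ N := fun hmem => ha1 ((QuotientGroup.eq_one_iff a).2 hmem)
  have habN : a * b ∈ N := by
    rw [← QuotientGroup.eq_one_iff, QuotientGroup.mk_mul]
    exact mul_eq_one_iff_eq_inv'.2 hba
  have hbN : b ∉ N := fun hmem => haN ((N.mul_mem_cancel_right hmem).1 habN)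
  have hbpos : o.lt 1 b := o.one_lt_iff.2 ⟨hb, fun h1 => hbN (h1 ▸ N.one_mem)⟩
  have hinv : o.lt 1 a⁻¹ := by simpa using h.one_lt_mul hbN (N.inv_mem habN) hbpos
  exact o.not_one_lt_inv (o.one_lt_iff.2 ⟨ha, fun h1 => haN (h1 ▸ N.one_mem)⟩) hinv

/-- The ordering of the quotient by a convex normal subgroup in which the class of a nonnegative
element is nonnegative. -/
def quotient (h : o.IsConvex N) : LeftOrdering (G ⧸ N) :=
  ofCone (o.oneLE.map (QuotientGroup.mk' N)) h.isMulPointed_map_oneLE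
    (o.isMulSpanning_map_oneLE (QuotientGroup.mk'_surjective N))

theorem quotient_one_lt_iff (h : o.IsConvex N) {g : G} (hg : g ∉ N) :
    h.quotient.lt 1 (g : G ⧸ N) ↔ o.lt 1 g := by
  rw [one_lt_iff, quotient, oneLE_ofCone, Ne, QuotientGroup.eq_one_iff]
  constructor
  · rintro ⟨⟨a, ha, hag⟩, -⟩
    have hmem : g⁻¹ * a ∈ N := QuotientGroup.eq.1 hag.symm
    have haN : a ∉ N := fun ha => hg (by simpa using N.mul_mem ha (N.inv_mem hmem))
    rw [← h.one_lt_mul_iff hg hmem, mul_inv_cancel_left]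
    exact o.one_lt_iff.2 ⟨ha, fun h1 => haN (h1 ▸ N.one_mem)⟩
  · exact fun hpos => ⟨⟨g, .inr hpos, rfl⟩, hg⟩

end IsConvex

theorem isConvex_iff_exists_quotient (o : LeftOrdering G) (N : Subgroup G) [N.Normal] :
    o.IsConvex N ↔ ∃ f : LeftOrdering (G ⧸ N), ∀ g ∉ N, o.lt 1 g ↔ f.lt 1 (g : G ⧸ N) := by
  refine ⟨fun h => ⟨h.quotient, fun g hg => (h.quotient_one_lt_iff hg).symm⟩, ?_⟩
  rintro ⟨f, hf⟩ g n hn hg hgn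
  by_contra hgN
  have hgnN : g⁻¹ * n ∉ N := fun h => hgN (N.inv_mem_iff.1 ((N.mul_mem_cancel_right hn).1 h))
  have hmk : ((g⁻¹ * n : G) : G ⧸ N) = (g : G ⧸ N)⁻¹ := by
    rw [QuotientGroup.mk_mul, (QuotientGroup.eq_one_iff n).2 hn, mul_one, QuotientGroup.mk_inv]
  have hinv := (hf _ hgnN).1 ((o.lt_iff_one_lt_inv_mul g n).1 hgn)
  exact f.not_one_lt_inv ((hf g hgN).1 hg) (hmk ▸ hinv)

section Lex

variable {Q : Type*} [Group Q]

/-- The lexicographic left ordering that compares images under `φ` first and breaks ties by `o`. -/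
def lex (φ : G →* Q) (q : LeftOrdering Q) (o : LeftOrdering G) : LeftOrdering G where
  lt a b := q.lt (φ a) (φ b) ∨ φ a = φ b ∧ o.lt a b
  irrefl a h := h.elim (q.irrefl _) fun h => o.irrefl _ h.2
  trans a b c := by
    rintro (hab | ⟨hab, hab'⟩) (hbc | ⟨hbc, hbc'⟩)
    · exact .inl (q.trans _ _ _ hab hbc)
    · exact .inl (hbc ▸ hab)
    · exact .inl (hab ▸ hbc)
    · exact .inr ⟨hab.trans hbc, o.trans _ _ _ hab' hbc'⟩
  total a b := by
    rcases q.total (φ a) (φ b) with h | h | h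
    · exact .inl (.inl h)
    · exact (o.total a b).imp (fun h' => .inr ⟨h, h'⟩) (Or.imp_right fun h' => .inr ⟨h.symm, h'⟩)
    · exact .inr (.inr (.inl h))
  mul_left a b c h := by
    simp only [map_mul]
    exact h.imp (q.mul_left _ _ _) fun h => ⟨congrArg _ h.1, o.mul_left _ _ _ h.2⟩

variable {φ : G →* Q} {q : LeftOrdering Q} {o : LeftOrdering G}

theorem lex_mem_BiO (hq : q ∈ BiO Q) (ho : o ∈ BiO G) : lex φ q o ∈ BiO G := fun a b c h => by
  simp only [lex, map_mul]
  exact h.imp (hq _ _ _) fun h => ⟨congrArg (· * φ c) h.1, ho _ _ _ h.2⟩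

theorem lex_one_lt {g : G} (hq : φ g ∈ q.oneLE) (ho : o.lt 1 g) : (lex φ q o).lt 1 g := by
  simp only [lex, map_one]
  exact hq.symm.imp_right fun h => ⟨h.symm, ho⟩

theorem lex_one_lt_iff_of_ne {g : G} (hg : φ g ≠ 1) : (lex φ q o).lt 1 g ↔ q.lt 1 (φ g) := by
  simp [lex, hg.symm]

theorem IsConvex.lex {N : Subgroup G} (h : o.IsConvex N) (hN : N ≤ φ.ker) :
    (lex φ q o).IsConvex N := by
  intro g n hn hg hgn
  have hφn : φ n = 1 := hN hn
  simp only [LeftOrdering.lex, map_one, hφn] at hg hgn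
  rcases hg with hg | ⟨hφg, hg⟩
  · exact absurd hg (hgn.elim q.asymm fun hgn => hgn.1 ▸ q.irrefl _)
  · exact h hn hg (hgn.resolve_left (hφg ▸ q.irrefl _)).2

end Lex

end Group

end LeftOrdering

section CommGroup

variable {Q : Type*} [CommGroup Q]

/-- The submonoid of all roots of the elements of `M`. -/
def rootSubmonoid (M : Submonoid Q) : Submonoid Q where
  carrier := {a | ∃ n : ℕ, n ≠ 0 ∧ a ^ n ∈ M}
  one_mem' := ⟨1, one_ne_zero, by simp⟩
  mul_mem' := by
    rintro a b ⟨n, hn, ha⟩ ⟨m, hm, hb⟩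
    refine ⟨n * m, mul_ne_zero hn hm, ?_⟩
    rw [mul_pow, pow_mul, pow_mul' b]
    exact mul_mem (pow_mem ha m) (pow_mem hb n)

variable {M N : Submonoid Q}

theorem le_rootSubmonoid (M : Submonoid Q) : M ≤ rootSubmonoid M := fun a ha =>
  ⟨1, one_ne_zero, by rwa [pow_one]⟩

theorem rootSubmonoid_le_rootSubmonoid (h : M ≤ rootSubmonoid N) :
    rootSubmonoid M ≤ rootSubmonoid N := by
  rintro a ⟨n, hn, ha⟩
  obtain ⟨m, hm, ham⟩ := h ha
  exact ⟨n * m, mul_ne_zero hn hm, by rwa [pow_mul]⟩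

theorem isMulPointed_rootSubmonoid [IsMulTorsionFree Q] (hM : M.IsMulPointed) :
    (rootSubmonoid M).IsMulPointed := by
  rintro a ⟨n, hn, ha⟩ ⟨m, hm, ha'⟩
  have hpow : a ^ (n * m) = 1 := by
    refine hM _ (pow_mul a n m ▸ pow_mem ha m) ?_
    rw [← inv_pow, pow_mul']
    exact pow_mem ha' n
  exact (pow_eq_one_iff_left (mul_ne_zero hn hm)).1 hpow

theorem isMulPointed_sup_powers (hM : M.IsMulPointed) {a : Q} (ha : a⁻¹ ∉ rootSubmonoid M) :
    (M ⊔ Submonoid.powers a).IsMulPointed := by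
  intro x hx hx'
  obtain ⟨s, hs, _, ⟨n, rfl⟩, rfl⟩ := Submonoid.mem_sup.1 hx
  obtain ⟨t, ht, _, ⟨m, rfl⟩, hinv⟩ := Submonoid.mem_sup.1 hx'
  have hnm : n + m = 0 := by
    by_contra hne
    refine ha ⟨n + m, hne, ?_⟩
    have hst : s * t * a ^ (n + m) = 1 := by
      rw [pow_add, mul_mul_mul_comm, hinv, mul_inv_cancel]
    rw [inv_pow, ← eq_inv_of_mul_eq_one_left hst]
    exact mul_mem hs ht
  obtain ⟨rfl, rfl⟩ : n = 0 ∧ m = 0 := Nat.add_eq_zero_iff.1 hnm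
  simp only [pow_zero, mul_one] at hinv ⊢
  exact hM s hs (hinv ▸ ht)

theorem exists_ge_isMulPointed_isMulSpanning [IsMulTorsionFree Q] (hM : M.IsMulPointed) :
    ∃ N ≥ M, N.IsMulPointed ∧ N.IsMulSpanning := by
  obtain ⟨N, hMN, hN⟩ := zorn_le_nonempty₀ {N : Submonoid Q | N.IsMulPointed}
    (fun c hc hchain K₀ hK₀ => by
      refine ⟨sSup c, fun x hx hx' => ?_, fun K hK => le_sSup hK⟩
      rw [Submonoid.mem_sSup_of_directedOn ⟨K₀, hK₀⟩ hchain.directedOn] at hx hx'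
      obtain ⟨K, hK, hxK⟩ := hx
      obtain ⟨L, hL, hxL⟩ := hx'
      rcases hchain.total hK hL with hKL | hLK
      · exact hc hL x (hKL hxK) hxL
      · exact hc hK x hxK (hLK hxL)) M hM
  refine ⟨N, hMN, hN.prop, fun a => or_iff_not_imp_right.2 fun ha => ?_⟩
  have hroot : rootSubmonoid N ≤ N :=
    hN.le_of_ge (isMulPointed_rootSubmonoid hN.prop) (le_rootSubmonoid N)
  have hsup : N ⊔ Submonoid.powers a ≤ N :=
    hN.le_of_ge (isMulPointed_sup_powers hN.prop fun h => ha (hroot h)) le_sup_left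
  exact hsup (Submonoid.mem_sup_right (Submonoid.mem_powers a))

theorem isCyclic_of_forall_pow_mem_zpowers [IsMulTorsionFree Q] [Group.FG Q] (f : Q)
    (h : ∀ a : Q, ∃ n : ℕ, n ≠ 0 ∧ a ^ n ∈ Subgroup.zpowers f) : IsCyclic Q := by
  have hfin : Finite (Q ⧸ Subgroup.zpowers f) := by
    refine CommGroup.finite_of_fg_isMulTorsion _ fun q => ?_
    obtain ⟨a, rfl⟩ := QuotientGroup.mk_surjective q
    obtain ⟨n, hn, ha⟩ := h a
    exact isOfFinOrder_iff_pow_eq_one.2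
      ⟨n, Nat.pos_of_ne_zero hn, (QuotientGroup.eq_one_iff (a ^ n)).2 ha⟩
  let e := Nat.card (Q ⧸ Subgroup.zpowers f)
  have hpow : ∀ a : Q, a ^ e ∈ Subgroup.zpowers f := fun a =>
    (QuotientGroup.eq_one_iff (a ^ e)).1 (by rw [QuotientGroup.mk_pow]; exact pow_card_eq_one')
  refine isCyclic_of_injective ((powMonoidHom e).codRestrict (Subgroup.zpowers f) hpow) ?_
  exact fun a b hab => pow_left_injective Nat.card_pos.ne' (congrArg Subtype.val hab)

namespace LeftOrdering

variable (o : LeftOrdering Q)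

include o in
theorem isMulTorsionFree : IsMulTorsionFree Q :=
  isMulTorsionFree_iff_not_isOfFinOrder.2 fun _ ha hfin =>
    ha (o.eq_one_of_pow_eq_one hfin.orderOf_pos.ne' (pow_orderOf_eq_one _))

theorem oneLE_le_rootSubmonoid_of_unique {M : Submonoid Q} (hM : M ≤ o.oneLE)
    (huniq : ∀ o' : LeftOrdering Q, M ≤ o'.oneLE → o' = o) : o.oneLE ≤ rootSubmonoid M := by
  intro a ha
  by_contra hroot
  have := o.isMulTorsionFree
  have hMp : M.IsMulPointed := fun x hx hx' => o.isMulPointed_oneLE x (hM hx) (hM hx')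
  obtain ⟨N, hN, hNp, hNs⟩ := exists_ge_isMulPointed_isMulSpanning
    (isMulPointed_sup_powers hMp (a := a⁻¹) (by rwa [inv_inv]))
  have hNo : N = o.oneLE := by
    rw [← oneLE_ofCone hNp hNs, huniq (ofCone N hNp hNs)]
    rw [oneLE_ofCone]
    exact le_sup_left.trans hN
  have ha' : a⁻¹ ∈ o.oneLE := hNo ▸ hN (Submonoid.mem_sup_right (Submonoid.mem_powers _))
  exact hroot (o.isMulPointed_oneLE a ha ha' ▸ one_mem _)

theorem mem_rootSubmonoid_of_inv_mul_mem {M : Submonoid Q} (hM : M ≤ o.oneLE) {x y : Q}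
    (hx : x ∈ o.oneLE) (hy : y ∈ M) (hy1 : y ≠ 1)
    (hxy : y⁻¹ * x ∈ rootSubmonoid (M ⊔ Submonoid.powers x)) : x ∈ rootSubmonoid M := by
  obtain ⟨n, hn, hmem⟩ := hxy
  obtain ⟨s, hs, _, ⟨m, rfl⟩, hsm⟩ := Submonoid.mem_sup.1 hmem
  have hxn : x ^ n = y ^ n * s * x ^ m := by
    rw [mul_assoc, hsm, mul_pow, inv_pow, mul_inv_cancel_left]
  rcases lt_or_ge m n with hlt | hle
  · refine ⟨n - m, Nat.sub_ne_zero_of_lt hlt, ?_⟩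
    rw [pow_sub x hlt.le, hxn, mul_inv_cancel_right]
    exact mul_mem (pow_mem hy n) hs
  · have hinv : (y ^ n)⁻¹ = s * x ^ (m - n) := by
      rw [inv_eq_iff_mul_eq_one, pow_sub x hle, ← mul_assoc, ← mul_assoc, ← hxn, mul_inv_cancel]
    have hpow : y ^ n = 1 := o.isMulPointed_oneLE _ (pow_mem (hM hy) n)
      (hinv ▸ mul_mem (hM hs) (pow_mem hx _))
    exact absurd (o.eq_one_of_pow_eq_one hn hpow) hy1

theorem exists_oneLE_le_rootSubmonoid_powers (S : Finset Q) (hS : ∀ x ∈ S, x ∈ o.oneLE)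
    (h : o.oneLE ≤ rootSubmonoid (Submonoid.closure (S : Set Q))) :
    ∃ f, o.oneLE ≤ rootSubmonoid (Submonoid.powers f) := by
  classical
  obtain ⟨T, ⟨hT, hroot⟩, hmin⟩ := exists_minimal_of_wellFoundedLT
    (fun T : Finset Q => (∀ x ∈ T, x ∈ o.oneLE) ∧
      o.oneLE ≤ rootSubmonoid (Submonoid.closure (T : Set Q))) ⟨S, hS, h⟩
  have hclosure : ∀ x ∈ T, Submonoid.closure (T : Set Q) =
      Submonoid.closure (T.erase x : Set Q) ⊔ Submonoid.powers x := fun x hx => by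
    rw [Submonoid.powers_eq_closure, ← Submonoid.closure_union, Set.union_singleton,
      ← Finset.coe_insert, Finset.insert_erase hx]
  have hirred : ∀ x ∈ T, x ∉ rootSubmonoid (Submonoid.closure (T.erase x : Set Q)) := by
    refine fun x hx hmem => Finset.notMem_erase x T (hmin ⟨fun y hy =>
      hT y (Finset.mem_of_mem_erase hy), hroot.trans (rootSubmonoid_le_rootSubmonoid ?_)⟩
      (Finset.erase_subset x T) hx)
    rw [hclosure x hx]
    exact sup_le (le_rootSubmonoid _) (Submonoid.powers_le.2 hmem)
  -- If `y < x` in `T`, then `y⁻¹ * x` is a root of the monoid generated by `T`; a power of this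
  -- relation expresses a power of `x` through the rest of `T`, against minimality.
  have hnot_lt : ∀ x ∈ T, ∀ y ∈ T, ¬ o.lt y x := fun x hx y hy hyx => by
    refine hirred x hx (o.mem_rootSubmonoid_of_inv_mul_mem
      (Submonoid.closure_le.2 fun z hz => hT z (Finset.mem_of_mem_erase hz)) (hT x hx)
      (Submonoid.subset_closure (Finset.mem_erase.2
        ⟨fun h => o.irrefl y (by rwa [← h] at hyx), hy⟩))
      (fun h1 => hirred y hy (h1 ▸ one_mem _)) ?_)
    rw [← hclosure x hx]
    exact hroot (.inr ((o.lt_iff_one_lt_inv_mul y x).1 hyx))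
  have hsub : (T : Set Q).Subsingleton := fun x hx y hy => by_contra fun hxy =>
    (o.lt_or_gt_of_ne hxy).elim (hnot_lt y hy x hx) (hnot_lt x hx y hy)
  rcases hsub.eq_empty_or_singleton with hempty | ⟨f, hf⟩
  · exact ⟨1, by simpa [hempty] using hroot⟩
  · exact ⟨f, by rwa [hf, ← Submonoid.powers_eq_closure] at hroot⟩

theorem exists_ne_forall_mem_oneLE [Group.FG Q] (hcyc : ¬ IsCyclic Q) (S : Finset Q)
    (hS : ∀ x ∈ S, x ∈ o.oneLE) : ∃ q : LeftOrdering Q, q ≠ o ∧ ∀ x ∈ S, x ∈ q.oneLE := by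
  by_contra! huniq
  obtain ⟨f, hf⟩ := o.exists_oneLE_le_rootSubmonoid_powers S hS <|
    o.oneLE_le_rootSubmonoid_of_unique (Submonoid.closure_le.2 hS) fun o' ho' => by
      by_contra hne
      obtain ⟨x, hx, hx'⟩ := huniq o' hne
      exact hx' (ho' (Submonoid.subset_closure hx))
  have := o.isMulTorsionFree
  refine hcyc (isCyclic_of_forall_pow_mem_zpowers f fun a => ?_)
  rcases o.isMulSpanning_oneLE a with ha | ha
  · obtain ⟨n, hn, hmem⟩ := hf ha
    exact ⟨n, hn, Submonoid.powers_le_zpowers f hmem⟩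
  · obtain ⟨n, hn, hmem⟩ := hf ha
    exact ⟨n, hn, (Subgroup.inv_mem_iff _).1 (inv_pow a n ▸ Submonoid.powers_le_zpowers f hmem)⟩

end LeftOrdering

end CommGroup

section LowerCentralSeries

open scoped commutatorElement

variable {G : Type*} [Group G]

theorem sup_lowerCentralSeries_eq_top {H : Subgroup G} (h : H ⊔ commutator G = ⊤) (k : ℕ) :
    H ⊔ Subgroup.lowerCentralSeries ⊤ k = ⊤ := by
  induction k with
  | zero => exact sup_top_eq H
  | succ k ih =>
    set K := H ⊔ Subgroup.lowerCentralSeries ⊤ (k + 1)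
    have hcentral : ∀ n ∈ Subgroup.lowerCentralSeries (⊤ : Subgroup G) k, ∀ g, ⁅n, g⁆ ∈ K :=
      fun n hn g => le_sup_right (a := H)
        (Subgroup.commutator_mem_commutator hn (Subgroup.mem_top g))
    have hnormal : K.Normal := by
      rw [← Subgroup.normalizer_eq_top_iff, ← top_le_iff, ← ih]
      refine sup_le (le_sup_left.trans Subgroup.le_normalizer) ?_
      refine Subgroup.le_normalizer_iff.2 fun n hn g hg => ?_
      simpa [commutatorElement_def] using mul_mem (hcentral n hn g) hg
    have hcomm : commutator G ≤ K := by
      rw [commutator_def, Subgroup.commutator_le]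
      intro a _ b _
      have hle : H ⊔ Subgroup.lowerCentralSeries ⊤ k ≤ K ⊔ Subgroup.lowerCentralSeries ⊤ k :=
        sup_le_sup_right le_sup_left _
      obtain ⟨x, hx, n, hn, rfl⟩ :=
        Subgroup.mem_sup_of_normal_left.1 (hle (ih.ge (Subgroup.mem_top a)))
      rw [commutatorElement_mul_left_eq_conj_mul]
      have hxb : ⁅x, b⁆ ∈ K := Subgroup.commutator_le_left K ⊤
        (Subgroup.commutator_mem_commutator hx (Subgroup.mem_top b))
      exact mul_mem (hnormal.conj_mem _ (hcentral n hn b) x) hxb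
    exact top_le_iff.1 (h ▸ sup_le le_sup_left hcomm)

theorem abelianization_of_surjective : Function.Surjective (Abelianization.of (G := G)) :=
  QuotientGroup.mk_surjective

theorem exists_countable_sup_commutator_eq_top [hfg : Group.FG (Abelianization G)] :
    ∃ H : Subgroup G, Countable H ∧ H ⊔ commutator G = ⊤ := by
  obtain ⟨α, _, ψ, hψ⟩ := Group.fg_iff_exists_freeGroup_hom_surjective_finite.1 hfg
  choose s hs using abelianization_of_surjective (G := G)
  let φ : FreeGroup α →* G := FreeGroup.lift fun a => s (ψ (FreeGroup.of a))
  have hφ : Abelianization.of.comp φ = ψ :=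
    FreeGroup.ext_hom _ _ fun a => by simp [φ, hs]
  refine ⟨φ.range, φ.rangeRestrict_surjective.countable, ?_⟩
  rw [← Abelianization.ker_of, ← Subgroup.comap_map_eq, ← MonoidHom.range_comp, hφ,
    MonoidHom.range_eq_top.2 hψ, Subgroup.comap_top]

instance countable_quotient_lowerCentralSeries [Group.FG (Abelianization G)] (k : ℕ) :
    Countable (G ⧸ Subgroup.lowerCentralSeries (⊤ : Subgroup G) k) := by
  obtain ⟨H, _, hH⟩ := exists_countable_sup_commutator_eq_top (G := G)
  have hrange : ((QuotientGroup.mk' (Subgroup.lowerCentralSeries (⊤ : Subgroup G) k)).comp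
      H.subtype).range = ⊤ := by
    rw [MonoidHom.range_comp, H.range_subtype, ← Subgroup.map_top_of_surjective _
      (QuotientGroup.mk'_surjective _), Subgroup.map_eq_map_iff, QuotientGroup.ker_mk',
      sup_lowerCentralSeries_eq_top hH, top_sup_eq]
  exact (MonoidHom.range_eq_top.1 hrange).countable

theorem isCyclic_of_isCyclic_abelianization [hcyc : IsCyclic (Abelianization G)]
    (hG : (⨅ k : ℕ, Subgroup.lowerCentralSeries (⊤ : Subgroup G) k) = ⊥) : IsCyclic G := by
  obtain ⟨x, hx⟩ := hcyc.exists_generator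
  obtain ⟨g, rfl⟩ := abelianization_of_surjective x
  have hsup : Subgroup.zpowers g ⊔ commutator G = ⊤ := by
    rw [← Abelianization.ker_of, ← Subgroup.comap_map_eq, MonoidHom.map_zpowers,
      (Subgroup.eq_top_iff' _).2 hx, Subgroup.comap_top]
  have hbot : commutator G = ⊥ := le_bot_iff.1 <| hG ▸ le_iInf fun k =>
    Subgroup.Normal.commutator_le_of_self_sup_commutative_eq_top
      (by rw [sup_comm, sup_lowerCentralSeries_eq_top hsup]) inferInstance
  rw [hbot, sup_bot_eq] at hsup
  exact ⟨g, (Subgroup.eq_top_iff' _).1 hsup⟩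

end LowerCentralSeries

section Standard

variable {G : Type*} [Group G]

theorem fg_abelianization_of_fg_LCSFactor_zero (h : Group.FG (LCSFactor G 0)) :
    Group.FG (Abelianization G) := by
  let φ : LCSFactor G 0 →* Abelianization G :=
    QuotientGroup.lift _ (Abelianization.of.comp (Subgroup.subtype _)) fun g hg => by
      rw [Subgroup.mem_subgroupOf, Subgroup.top_lowerCentralSeries_one] at hg
      exact (QuotientGroup.eq_one_iff _).2 hg
  refine Group.fg_of_surjective (f := φ) fun x => ?_
  obtain ⟨g, rfl⟩ := abelianization_of_surjective x
  exact ⟨QuotientGroup.mk ⟨g, Subgroup.mem_top g⟩, rfl⟩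

theorem mem_SBiO_iff {o : BiO G} :
    o ∈ SBiO G ↔ ∀ k, o.1.IsConvex (Subgroup.lowerCentralSeries (⊤ : Subgroup G) k) := by
  have hfactor : o ∈ SBiO G ↔ ∀ k,
      (o.1.restrict (Subgroup.lowerCentralSeries (⊤ : Subgroup G) k)).IsConvex
        ((Subgroup.lowerCentralSeries (⊤ : Subgroup G) (k + 1)).subgroupOf _) := by
    simp only [LeftOrdering.isConvex_iff_exists_quotient]
    exact ⟨fun ⟨f, hf⟩ k => ⟨f k, hf k⟩, fun h => ⟨fun k => (h k).choose, fun k =>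
      (h k).choose_spec⟩⟩
  rw [hfactor]
  refine ⟨fun h k => ?_, fun h k => (h (k + 1)).subgroupOf _⟩
  induction k with
  | zero => exact fun g _ _ _ _ => Subgroup.mem_top g
  | succ k ih => exact .of_subgroupOf (Subgroup.lowerCentralSeries_antitone _ k.le_succ) ih (h k)

theorem isClosed_SBiO : IsClosed (SBiO G) := by
  have hSBiO : SBiO G = Subtype.val ⁻¹' ⋂ (k : ℕ) (g : G) (n : G)
      (_ : n ∈ Subgroup.lowerCentralSeries (⊤ : Subgroup G) k)
      (_ : g ∉ Subgroup.lowerCentralSeries (⊤ : Subgroup G) k),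
      (LeftOrdering.U 1 g ∩ LeftOrdering.U g n)ᶜ := by
    ext o
    simp only [mem_SBiO_iff, LeftOrdering.IsConvex, LeftOrdering.U, Set.mem_preimage,
      Set.mem_iInter, Set.mem_compl_iff, Set.mem_inter_iff, Set.mem_ofPred_eq]
    grind
  rw [hSBiO]
  refine IsClosed.preimage continuous_subtype_val (isClosed_iInter fun k =>
    isClosed_iInter fun g => isClosed_iInter fun n => isClosed_iInter fun _ =>
    isClosed_iInter fun _ => IsOpen.isClosed_compl ?_)
  exact (LeftOrdering.isOpen_U 1 g).inter (LeftOrdering.isOpen_U g n)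

theorem lex_mem_SBiO (q : LeftOrdering (Abelianization G)) {o : BiO G} (ho : o ∈ SBiO G) :
    (⟨LeftOrdering.lex Abelianization.of q o.1, LeftOrdering.lex_mem_BiO q.mem_BiO o.2⟩ : BiO G) ∈
      SBiO G := by
  refine mem_SBiO_iff.2 fun k => ?_
  cases k with
  | zero => exact fun g _ _ _ _ => Subgroup.mem_top g
  | succ k =>
    refine (mem_SBiO_iff.1 ho (k + 1)).lex ?_
    rw [Abelianization.ker_of, ← Subgroup.top_lowerCentralSeries_one]
    exact Subgroup.lowerCentralSeries_antitone _ (Nat.le_add_left 1 k)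

theorem exists_ne_mem_SBiO [Group.FG (Abelianization G)] (hcyc : ¬ IsCyclic (Abelianization G))
    {o : BiO G} (ho : o ∈ SBiO G) (T : Finset G) (hT : ∀ g ∈ T, o.1.lt 1 g) :
    ∃ o' ∈ SBiO G, o' ≠ o ∧ ∀ g ∈ T, o'.1.lt 1 g := by
  classical
  obtain ⟨f, hf⟩ : ∃ f : LeftOrdering (Abelianization G), ∀ g ∉ commutator G,
      o.1.lt 1 g ↔ f.lt 1 (Abelianization.of g) :=
    (o.1.isConvex_iff_exists_quotient _).1
      (Subgroup.top_lowerCentralSeries_one (G := G) ▸ mem_SBiO_iff.1 ho 1)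
  simp only [← Abelianization.ker_of, MonoidHom.mem_ker] at hf
  obtain ⟨q, hqf, hqT⟩ := f.exists_ne_forall_mem_oneLE hcyc (T.image Abelianization.of) <|
    Finset.forall_mem_image.2 fun g hg => or_iff_not_imp_left.2 fun h1 => (hf g h1).1 (hT g hg)
  rw [Finset.forall_mem_image] at hqT
  refine ⟨_, lex_mem_SBiO q ho, fun heq => hqf (LeftOrdering.ext_one_lt fun x => ?_),
    fun g hg => LeftOrdering.lex_one_lt (hqT hg) (hT g hg)⟩
  have hlex : LeftOrdering.lex Abelianization.of q o.1 = o.1 := congrArg Subtype.val heq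
  obtain ⟨g, rfl⟩ := abelianization_of_surjective x
  rcases eq_or_ne (Abelianization.of g) 1 with h1 | h1
  · simp only [h1, LeftOrdering.irrefl]
  · rw [← hf g h1, ← hlex, LeftOrdering.lex_one_lt_iff_of_ne h1]

theorem perfectSpace_SBiO [Group.FG (Abelianization G)] (hcyc : ¬ IsCyclic (Abelianization G)) :
    PerfectSpace (SBiO G) := by
  refine ⟨fun o _ => accPt_iff_nhds.2 fun V hV => ?_⟩
  obtain ⟨s, hs, hsV⟩ : ∃ s ∈ nhds o.1.1, Subtype.val ∘ Subtype.val ⁻¹' s ⊆ V := by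
    rwa [nhds_subtype, nhds_subtype, Filter.comap_comap] at hV
  obtain ⟨T, hT, hTs⟩ := LeftOrdering.exists_finset_of_mem_nhds hs
  obtain ⟨o', ho', hne, ho'T⟩ := exists_ne_mem_SBiO hcyc o.2 T hT
  exact ⟨⟨o', ho'⟩, ⟨hsV (hTs o'.1 ho'T), trivial⟩, fun h => hne (congrArg Subtype.val h)⟩

theorem eq_of_forall_one_lt_out_iff
    (hG : (⨅ k : ℕ, Subgroup.lowerCentralSeries (⊤ : Subgroup G) k) = ⊥) {o o' : SBiO G}
    (h : ∀ (k : ℕ) (q : G ⧸ Subgroup.lowerCentralSeries (⊤ : Subgroup G) k),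
      o.1.1.lt 1 q.out ↔ o'.1.1.lt 1 q.out) : o = o' := by
  refine Subtype.ext (Subtype.ext (LeftOrdering.ext_one_lt fun g => ?_))
  rcases eq_or_ne g 1 with rfl | hg
  · simp only [LeftOrdering.irrefl]
  obtain ⟨k, hk⟩ : ∃ k, g ∉ Subgroup.lowerCentralSeries (⊤ : Subgroup G) k := by
    by_contra! hmem
    exact hg (by simpa [hG] using Subgroup.mem_iInf.2 hmem)
  obtain ⟨n, hn⟩ := QuotientGroup.mk_out_eq_mul (Subgroup.lowerCentralSeries ⊤ k) g
  rw [← (mem_SBiO_iff.1 o.2 k).one_lt_mul_iff hk n.2, ← hn, h, hn,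
    (mem_SBiO_iff.1 o'.2 k).one_lt_mul_iff hk n.2]

instance : CompactSpace (SBiO G) :=
  have : CompactSpace (BiO G) := isCompact_iff_compactSpace.1 LeftOrdering.isClosed_BiO.isCompact
  isCompact_iff_compactSpace.1 isClosed_SBiO.isCompact

theorem nonempty_homeomorph_cantorSet_SBiO [Group.FG (Abelianization G)]
    (hcyc : ¬ IsCyclic (Abelianization G))
    (hG : (⨅ k : ℕ, Subgroup.lowerCentralSeries (⊤ : Subgroup G) k) = ⊥)
    (hne : (SBiO G).Nonempty) : Nonempty (SBiO G ≃ₜ cantorSet) := by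
  have := perfectSpace_SBiO hcyc
  have := hne.to_subtype
  obtain ⟨e, he⟩ :=
    exists_surjective_nat (Σ k, G ⧸ Subgroup.lowerCentralSeries (⊤ : Subgroup G) k)
  let C (n : ℕ) : Set (SBiO G) := (fun o => o.1.1) ⁻¹' LeftOrdering.U 1 (e n).2.out
  have hC (n : ℕ) : IsClopen (C n) := (LeftOrdering.isClopen_U _ _).preimage
    (continuous_subtype_val.comp continuous_subtype_val)
  have hsep (o o' : SBiO G) (h : ∀ n, o ∈ C n ↔ o' ∈ C n) : o = o' :=
    eq_of_forall_one_lt_out_iff hG fun k q =>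
      he.forall (p := fun p => o.1.1.lt 1 p.2.out ↔ o'.1.1.lt 1 p.2.out).2 h ⟨k, q⟩
  obtain ⟨φ⟩ := nonempty_homeomorph_nat_bool hC hsep
  exact ⟨φ.trans cantorSetHomeomorphNatToBool.symm⟩

end Standard

theorem mainTheorem7_general (G : Type*) [Group G] :
    IsClosed (SBiO G) ∧
    ((⨅ k : ℕ, Subgroup.lowerCentralSeries (⊤ : Subgroup G) k) = ⊥ → Nontrivial G →
      IsEmpty (G ≃* Multiplicative ℤ) → Group.FG (Abelianization G) →
      SBiO G = ∅ ∨ Nonempty (SBiO G ≃ₜ cantorSet)) := by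
  refine ⟨isClosed_SBiO, fun hG _ hZ _ => (SBiO G).eq_empty_or_nonempty.imp_right fun hne => ?_⟩
  refine nonempty_homeomorph_cantorSet_SBiO (fun _ => ?_) hG hne
  have := isCyclic_of_isCyclic_abelianization hG
  have := hne.some.1.infinite
  exact hZ.false intCyclicMulEquiv.symm

theorem mainTheorem7 (G : Type*) [Group G] [Countable G]
    (hG : (⨅ k : ℕ, Subgroup.lowerCentralSeries (⊤ : Subgroup G) k) = ⊥) :
    IsClosed (SBiO G) ∧
    (Nontrivial G → IsEmpty (G ≃* Multiplicative ℤ) → (∀ k : ℕ, Group.FG (LCSFactor G k)) →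
      SBiO G = ∅ ∨ Nonempty (SBiO G ≃ₜ cantorSet)) := by
  exact ⟨(mainTheorem7_general G).1, fun hnt hZ hfg =>
    (mainTheorem7_general G).2 hG hnt hZ (fg_abelianization_of_fg_LCSFactor_zero (hfg 0))⟩
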